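/- **Setting.** Let $\Omega\subseteq\mathbb R^{\mathsf d}$ be open and bounded and let $E(\mu)=\sum_i f_i(\mu)E_i$, $A(\mu)=\sum_i g_i(\mu)A_i$, $B(\mu)=\sum_i h_i(\mu)B_i$, $C(\mu)=\sum_i k_i(\mu)C_i$ (finite sums) with real matrices $E_i,A_i\in\mathbb R^{\mathsf n\times \mathsf n}$, $B_i\in\mathbb R^{\mathsf n\times \mathsf m}$, $C_i\in\mathbb R^{\mathsf p\times \mathsf n}$ and real-analytic functions $f_i,g_i,h_i,k_i:\Omega\to\mathbb R$. Put $D(\mu,s)=sE(\mu)-A(\mu)$ and $H[\mu](s)=C(\mu)D(\mu,s)^{-1}B(\mu)$. For $\omega\in\mathbb R\cup\{\infty\}$ let $\sigma(\mu,\omega)$ be the largest singular value of the rational function $H[\mu]$ at $\mathrm i\omega$ (as a limit at $\omega=\infty$ and where $D(\mu,\mathrm i\omega)$ is singular). For $V,W\in\mathbb C^{\mathsf n\times r}$ with orthonormal columns, $D^{V,W}$, $H^{V,W}$ and $\sigma^{V,W}$ denote the same objects for the reduced system, in which $E_i,A_i,B_i,C_i$ are replaced by $W^*E_iV,\,W^*A_iV,\,W^*B_i,\,C_iV$.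 $\sigma_{\min}$ denotes the smallest singular value. Let $\underline\Omega\subset\Omega$ be compact such that, for every $\mu\in\underline\Omega$, $H[\mu]$ is well-defined (regular pencil) and belongs to $\mathcal H_\infty$, and let $\mu_*\in\underline\Omega$ be a local or global minimizer over $\underline\Omega$ of $\mu\mapsto\|H[\mu]\|_{\mathcal H_\infty}=\sup_{\operatorname{Re}s>0}\|H[\mu](s)\|_2$. **Algorithm.** From initial subspaces $\mathcal V_0,\mathcal W_0\subseteq\mathbb C^{\mathsf n}$ of equal dimension, iteration $j=1,2,\dots$ of the *basic algorithm* chooses $\mu^{(j)}$ as a minimizer over $\underline\Omega$ of the norm $\sup_{\omega\in\mathbb R}\sigma^{\mathcal V_{j-1},\mathcal W_{j-1}}(\mu,\omega)$ of the reduced system (taken as $+\infty$ where the reduced pencil is not regular), then a maximizer $\omega^{(j)}\in\mathbb R$ of $\sigma(\mu^{(j)},\cdot)$ at which $D(\mu^{(j)},\mathrm i\omega^{(j)})$ is invertible, and sets $\mathcal V_j=\mathcal V_{j-1}+\mathrm{Col}(\widetilde V_j)$, $\mathcal W_j=\mathcal W_{j-1}+\mathrm{Col}(\widetilde W_j)$,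 where, with $D,B,C,H$ evaluated at $(\mu^{(j)},\mathrm i\omega^{(j)})$, $\widetilde V_j=D^{-1}B$ if $\mathsf m\le\mathsf p$ and $\widetilde V_j=D^{-1}BH^*$ if $\mathsf m>\mathsf p$, and $\widetilde W_j=D^{-*}C^*$ if $\mathsf m\ge\mathsf p$ and $\widetilde W_j=D^{-*}C^*H$ if $\mathsf m<\mathsf p$. The *extended algorithm* in addition enlarges the spaces for $j\ge2$ in the same way at the points $\mu^{(j,aq)}=\mu^{(j)}+\|\mu^{(j)}-\mu^{(j-1)}\|_2\,e_{aq}\in\Omega$, $1\le a\le q\le\mathsf d$, with maximizers $\omega^{(j,aq)}$ of $\sigma(\mu^{(j,aq)},\cdot)$, where $e_{aa}=e_a$ and $e_{aq}=(e_a+e_q)/\sqrt2$ for $a\ne q$. The spaces $\mathcal V_j,\mathcal W_j$ are supposed to have the same dimension; $V_j,W_j$ have orthonormal columns spanning them. **Assumptions.** Let $\omega_*\in\mathbb R$ be such that (i) the supremum of $\sigma(\mu_*,\cdot)$ over $\mathbb R\cup\{\infty\}$ is attained at $\omega_*$ and, up to the sign of the frequency (the data being real, $\sigma(\mu,-\omega)=\sigma(\mu,\omega)$),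 only there; (ii) $\sigma(\mu_*,\omega_*)>0$ is a simple singular value of $H[\mu_*](\mathrm i\omega_*)$; and (iii) $\sigma$, as a function on $\underline\Omega\times(\mathbb R\cup\{\infty\})$, is continuous at the points of $\{\mu_*\}\times(\mathbb R\cup\{\infty\})$. Let $\beta>0$ with $\sigma_{\min}(D(\mu_*,\mathrm i\omega_*))\ge\beta$, and let $k\ge1$. **Lemma 3.3.** There exist $U$ and $\eta_\mu,\eta_\omega>0$, with $\overline{\mathcal B}(\mu_*,\eta_\mu)\subseteq\Omega$, such that the following holds for every family $R$ of runs ($k$ iterations) of the basic or the extended algorithm for which $\omega_*\omega^{(k)}\ge0$ and for which $\mu^{(k)}\to\mu_*$ as $\mu^{(1)}\to\mu_*$. If $\|\mu^{(1)}-\mu_*\|_2$ is small enough, then every run in $R$ with $$\sigma_{\min}\big(D^{V_k,W_k}(\mu_*,\mathrm i\omega_*)\big)\ge\beta$$ satisfies, for all $\mu\in\overline{\mathcal B}(\mu_*,\eta_\mu)$ and all $\omega\in\overline{\mathcal B}(\omega_*,\eta_\omega)$: $D^{V_k,W_k}(\mu,\mathrm i\omega)$ is nonsingular, $\sigma^{\mathcal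 V_k,\mathcal W_k}$ is three times continuously differentiable at $(\mu,\omega)$, and $$\big|\sigma^{\mathcal V_k,\mathcal W_k}_{\chi_1}(\mu,\omega)\big|\le U,\qquad \big|\sigma^{\mathcal V_k,\mathcal W_k}_{\chi_1\chi_2}(\mu,\omega)\big|\le U,\qquad \big|\sigma^{\mathcal V_k,\mathcal W_k}_{\chi_1\chi_2\chi_3}(\mu,\omega)\big|\le U$$ for all $\chi_1,\chi_2,\chi_3\in\{\omega\}\cup\{\mu_j\mid j=1,\dots,\mathsf d\}$. In particular $U,\eta_\mu,\eta_\omega$ do not depend on $\mu^{(1)}$ (nor on the initial subspaces). -/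

import Mathlib

open Filter Topology Matrix
open scoped OnePoint

noncomputable section

/-- The parameter space `ℝ^d` with the Euclidean norm. -/
abbrev Param (d : ℕ) : Type := EuclideanSpace ℝ (Fin d)

/-- The singular values of a complex matrix in descending order, with multiplicity, numbered from
`0` (and continued by zeros). -/
def singVal {a b : ℕ} (M : Matrix (Fin a) (Fin b) ℂ) (i : ℕ) : ℝ :=
  (Matrix.toEuclideanLin M).singularValues i

/-- The smallest singular value of a square matrix (it is `0` for the matrix of size `0`). -/
def sigmaMin {r : ℕ} (M : Matrix (Fin r) (Fin r) ℂ) : ℝ :=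
  singVal M (r - 1)

/-- The column space of a matrix. -/
def colSpace {a b : ℕ} (M : Matrix (Fin a) (Fin b) ℂ) : Submodule ℂ (Fin a → ℂ) :=
  LinearMap.range M.mulVecLin

/-- A (full or reduced) parameter-dependent descriptor system of order `r` with `m` inputs and
`p` outputs, given by its coefficient functions. -/
structure StateSpace (d r m p : ℕ) where
  E : Param d → Matrix (Fin r) (Fin r) ℂ
  A : Param d → Matrix (Fin r) (Fin r) ℂ
  B : Param d → Matrix (Fin r) (Fin m) ℂ
  C : Param d → Matrix (Fin p) (Fin r) ℂ

namespace StateSpace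

variable {d r m p : ℕ} (G : StateSpace d r m p)

/-- `D(μ, s) = s E(μ) - A(μ)`. -/
def D (μ : Param d) (s : ℂ) : Matrix (Fin r) (Fin r) ℂ := s • G.E μ - G.A μ

/-- The pencil `s ↦ D(μ, s)` is regular. -/
def Regular (μ : Param d) : Prop := ∃ s : ℂ, (G.D μ s).det ≠ 0

/-- The transfer function `H[μ](s) = C(μ) D(μ, s)⁻¹ B(μ)`, where `D(μ, s)` is nonsingular. -/
def H (μ : Param d) (s : ℂ) : Matrix (Fin p) (Fin m) ℂ := G.C μ * (G.D μ s)⁻¹ * G.B μ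

/-- `D(μ, iω)`. -/
def Di (μ : Param d) (ω : ℝ) : Matrix (Fin r) (Fin r) ℂ := G.D μ (Complex.I * ω)

/-- `H[μ](iω)`. -/
def Hi (μ : Param d) (ω : ℝ) : Matrix (Fin p) (Fin m) ℂ := G.H μ (Complex.I * ω)

/-- `σ(μ, ω)`, the largest singular value of `H[μ](iω)`. -/
def sigma (μ : Param d) (ω : ℝ) : ℝ := singVal (G.Hi μ ω) 0

/-- `σ(μ, ω)` for all frequencies `ω ∈ ℝ ∪ {∞}` of the rational function `H[μ]`: the value at `∞`
and at the (finitely many) frequencies at which `D(μ, iω)` is singular is the limit. Where `D(μ, iω)`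
is nonsingular this is `G.sigma μ ω`. -/
def sigmaExt (μ : Param d) : OnePoint ℝ → ℝ
  | ∞ => limUnder (cocompact ℝ) (G.sigma μ)
  | (ω : ℝ) => limUnder (𝓝[≠] ω) (G.sigma μ)

/-- The `H_∞`-norm `sup_{Re s > 0} ‖H[μ](s)‖₂` of a system with a regular pencil. The finitely many
points at which `D(μ, s)` is singular may be left out, since `H[μ]` is rational. -/
def hinfNorm (μ : Param d) : ENNReal :=
  ⨆ (s : ℂ) (_ : 0 < s.re) (_ : (G.D μ s).det ≠ 0), ENNReal.ofReal (singVal (G.H μ s) 0)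

/-- `H[μ]` is well-defined and belongs to `H_∞`. -/
def MemHinf (μ : Param d) : Prop := G.Regular μ ∧ G.hinfNorm μ < ⊤

open Classical in
/-- The `L_∞`-norm `sup_ω σ(μ, ω)`, with the value `∞` if `H[μ]` is not defined. The finitely many
frequencies at which `D(μ, iω)` is singular may be left out, since `H[μ]` is rational. -/
def linfNorm (μ : Param d) : ENNReal :=
  if G.Regular μ then ⨆ (ω : ℝ) (_ : (G.Di μ ω).det ≠ 0), ENNReal.ofReal (G.sigma μ ω) else ⊤

/-- `ω` is a maximizer of `σ(μ, ·)` at which `D(μ, iω)` can be inverted. -/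
def IsMaxFreq (μ : Param d) (ω : ℝ) : Prop :=
  (G.Di μ ω).det ≠ 0 ∧ ∀ ω' : ℝ, (G.Di μ ω').det ≠ 0 → G.sigma μ ω' ≤ G.sigma μ ω

/-- The subspace by which the right projection space is enlarged for the pair `(μ, ω)`. -/
def expandV (μ : Param d) (ω : ℝ) : Submodule ℂ (Fin r → ℂ) :=
  if m ≤ p then colSpace ((G.Di μ ω)⁻¹ * G.B μ)
  else colSpace ((G.Di μ ω)⁻¹ * G.B μ * (G.Hi μ ω)ᴴ)

/-- The subspace by which the left projection space is enlarged for the pair `(μ, ω)`. -/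
def expandW (μ : Param d) (ω : ℝ) : Submodule ℂ (Fin r → ℂ) :=
  if p ≤ m then colSpace (((G.Di μ ω)⁻¹)ᴴ * (G.C μ)ᴴ)
  else colSpace (((G.Di μ ω)⁻¹)ᴴ * (G.C μ)ᴴ * G.Hi μ ω)

/-- The smoothness assumption at `(μ₀, ω₀)`: the supremum of `σ(μ₀, ·)` over `ℝ ∪ {∞}` is attained at
`ω₀` and, up to the sign of the frequency, only there; and `σ(μ₀, ω₀)` is positive and a simple
singular value of `H[μ₀](iω₀)`. -/
def Smooth (μ₀ : Param d) (ω₀ : ℝ) : Prop :=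
  (∀ ω : OnePoint ℝ, ω ≠ ((ω₀ : ℝ) : OnePoint ℝ) → ω ≠ ((-ω₀ : ℝ) : OnePoint ℝ) →
    G.sigmaExt μ₀ ω < G.sigma μ₀ ω₀) ∧
  0 < singVal (G.Hi μ₀ ω₀) 0 ∧ singVal (G.Hi μ₀ ω₀) 1 < singVal (G.Hi μ₀ ω₀) 0

end StateSpace

/-- The data of the problem: an open and bounded parameter set `Ω`, real matrices, and scalar
functions that are real-analytic on `Ω`. -/
structure ParamSystem (d n m p : ℕ) where
  Ω : Set (Param d)
  isOpen : IsOpen Ω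
  isBounded : Bornology.IsBounded Ω
  κE : ℕ
  κA : ℕ
  κB : ℕ
  κC : ℕ
  E : Fin κE → Matrix (Fin n) (Fin n) ℝ
  A : Fin κA → Matrix (Fin n) (Fin n) ℝ
  B : Fin κB → Matrix (Fin n) (Fin m) ℝ
  C : Fin κC → Matrix (Fin p) (Fin n) ℝ
  f : Fin κE → Param d → ℝ
  g : Fin κA → Param d → ℝ
  h : Fin κB → Param d → ℝ
  k : Fin κC → Param d → ℝ
  analytic_f : ∀ i, AnalyticOnNhd ℝ (f i) Ω
  analytic_g : ∀ i, AnalyticOnNhd ℝ (g i) Ω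
  analytic_h : ∀ i, AnalyticOnNhd ℝ (h i) Ω
  analytic_k : ∀ i, AnalyticOnNhd ℝ (k i) Ω

/-- A real matrix as a complex matrix. -/
def toC {a b : ℕ} (M : Matrix (Fin a) (Fin b) ℝ) : Matrix (Fin a) (Fin b) ℂ :=
  M.map (fun x : ℝ => (x : ℂ))

namespace ParamSystem

variable {d n m p : ℕ} (S : ParamSystem d n m p)

/-- The full system. -/
def full : StateSpace d n m p where
  E μ := ∑ i, (S.f i μ : ℂ) • toC (S.E i)
  A μ := ∑ i, (S.g i μ : ℂ) • toC (S.A i)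
  B μ := ∑ i, (S.h i μ : ℂ) • toC (S.B i)
  C μ := ∑ i, (S.k i μ : ℂ) • toC (S.C i)

/-- The system reduced by the matrices `V` and `W`. -/
def reduced {r : ℕ} (V W : Matrix (Fin n) (Fin r) ℂ) : StateSpace d r m p where
  E μ := ∑ i, (S.f i μ : ℂ) • (Wᴴ * toC (S.E i) * V)
  A μ := ∑ i, (S.g i μ : ℂ) • (Wᴴ * toC (S.A i) * V)
  B μ := ∑ i, (S.h i μ : ℂ) • (Wᴴ * toC (S.B i))
  C μ := ∑ i, (S.k i μ : ℂ) • (toC (S.C i) * V)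

end ParamSystem

/-- The quantities produced by the subspace algorithms: the parameters `μ⁽ʲ⁾` and the frequencies
`ω⁽ʲ⁾` (`j ≥ 1`), and the matrices `V_j`, `W_j` (`j ≥ 0`) whose columns are bases of the projection
spaces. The spaces `𝒱_j`, `𝒲_j` have the same dimension `dim j`. -/
structure Iterates (d n : ℕ) where
  dim : ℕ → ℕ
  V : ∀ j, Matrix (Fin n) (Fin (dim j)) ℂ
  W : ∀ j, Matrix (Fin n) (Fin (dim j)) ℂ
  μ : ℕ → Param d
  ω : ℕ → ℝ

namespace ParamSystem

variable {d n m p : ℕ} (S : ParamSystem d n m p)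

/-- The reduced system with the projection spaces `𝒱_j`, `𝒲_j`. -/
def reducedAt (it : Iterates d n) (j : ℕ) : StateSpace d (it.dim j) m p :=
  S.reduced (it.V j) (it.W j)

/-- What the two algorithms have in common in the iterations `1, …, k`, over the compact parameter
set `K`: the bases are orthonormal, `μ⁽ʲ⁺¹⁾` minimizes the norm of the system reduced by `𝒱_j`,
`𝒲_j`, and `ω⁽ʲ⁺¹⁾` maximizes `σ(μ⁽ʲ⁺¹⁾, ·)`. -/
def IsGreedy (K : Set (Param d)) (k : ℕ) (it : Iterates d n) : Prop :=
  (∀ j ≤ k, (it.V j)ᴴ * it.V j = 1 ∧ (it.W j)ᴴ * it.W j = 1) ∧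
  ∀ j < k,
    (it.μ (j + 1) ∈ K ∧
      ∀ ν ∈ K, (S.reducedAt it j).linfNorm (it.μ (j + 1)) ≤ (S.reducedAt it j).linfNorm ν) ∧
    S.full.IsMaxFreq (it.μ (j + 1)) (it.ω (j + 1))

/-- The first `k` iterations of the basic greedy algorithm. -/
def IsBasicRun (K : Set (Param d)) (k : ℕ) (it : Iterates d n) : Prop :=
  S.IsGreedy K k it ∧
  ∀ j < k,
    colSpace (it.V (j + 1)) =
      colSpace (it.V j) ⊔ S.full.expandV (it.μ (j + 1)) (it.ω (j + 1)) ∧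
    colSpace (it.W (j + 1)) =
      colSpace (it.W j) ⊔ S.full.expandW (it.μ (j + 1)) (it.ω (j + 1))

/-- `e_{aq} = (e_a + e_q) / √2` for `a ≠ q`, and `e_{aa} = e_a`. -/
def dirVec (a q : Fin d) : Param d :=
  if a = q then EuclideanSpace.single a 1
  else (1 / Real.sqrt 2) • (EuclideanSpace.single a 1 + EuclideanSpace.single q 1)

/-- The additional interpolation points `μ⁽ʲ⁺¹⁾ + h e_{aq}` of the extended algorithm in iteration
`j + 1 ≥ 2`, with `h = ‖μ⁽ʲ⁺¹⁾ - μ⁽ʲ⁾‖`. -/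
def extraPoint (it : Iterates d n) (j : ℕ) (a q : Fin d) : Param d :=
  it.μ (j + 1) + ‖it.μ (j + 1) - it.μ j‖ • dirVec a q

/-- The first `k` iterations of the extended greedy algorithm. -/
def IsExtendedRun (K : Set (Param d)) (k : ℕ) (it : Iterates d n) : Prop :=
  S.IsGreedy K k it ∧
  ∀ j < k, ∃ ω' : Fin d → Fin d → ℝ,
    (1 ≤ j → ∀ a q, a ≤ q →
      extraPoint it j a q ∈ S.Ω ∧ S.full.IsMaxFreq (extraPoint it j a q) (ω' a q)) ∧
    colSpace (it.V (j + 1)) =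
      colSpace (it.V j) ⊔ S.full.expandV (it.μ (j + 1)) (it.ω (j + 1)) ⊔
        ⨆ (_ : 1 ≤ j) (a : Fin d) (q : Fin d) (_ : a ≤ q),
          S.full.expandV (extraPoint it j a q) (ω' a q) ∧
    colSpace (it.W (j + 1)) =
      colSpace (it.W j) ⊔ S.full.expandW (it.μ (j + 1)) (it.ω (j + 1)) ⊔
        ⨆ (_ : 1 ≤ j) (a : Fin d) (q : Fin d) (_ : a ≤ q),
          S.full.expandW (extraPoint it j a q) (ω' a q)

end ParamSystem

/-- The coordinate directions of `(μ, ω) ∈ ℝ^d × ℝ`: `none` stands for `ω`, `some j` for `μ_j`. -/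
def coordDir {d : ℕ} : Option (Fin d) → Param d × ℝ
  | none => (0, 1)
  | some j => (EuclideanSpace.single j 1, 0)

/-- The partial derivative `F_χ` of a function of `(μ, ω)`. -/
def partialDeriv {d : ℕ} (χ : Option (Fin d)) (F : Param d × ℝ → ℝ) : Param d × ℝ → ℝ :=
  fun x => lineDeriv ℝ F x (coordDir χ)

end

-- The bounds are uniform because everything that varies between runs lies in a compact set. The
-- reduced transfer function is a jointly smooth function of `(μ, ω, V, W)` wherever the reduced
-- matrix is nonsingular. For each order `r ≤ n`, the pairs of orthonormal bases with
-- `σ_min(D^{V,W}(μ₀, iω₀)) ≥ β` form a compact set (`isCompact_boundedBelowBases`). Nonsingularity,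
-- smoothness and derivative bounds at `(μ₀, ω₀)` therefore extend to one neighbourhood that serves
-- all these bases (`exists_uniform_partialDeriv_bound`).
--
-- The largest singular value is a smooth function of the matrix only where it is simple
-- (`contDiffAt_singVal_zero`), and simplicity has to be carried over from the full to the reduced
-- system. By interpolation (`reduced_Hi_eq`) the two transfer functions agree at `(μ⁽ᵏ⁾, ω⁽ᵏ⁾)`.
-- This point is close to `(μ₀, ω₀)`: the parameter by the convergence hypothesis, the frequency
-- because the maximizer at `μ₀` is unique up to sign (`eventually_isMaxFreq_dist_lt`).
-- Equicontinuity over the compact set of bases then keeps the reduced transfer function near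
-- `H[μ₀](iω₀)`, whose largest singular value is simple, on the whole neighbourhood
-- (`exists_uniform_bound_singVal_zero`).

attribute [local instance] Matrix.normedAddCommGroup Matrix.normedSpace

/-! ### Singular values: variational bounds and the characteristic polynomial -/

theorem norm_sq_eq_sum_singularValues {E F : Type*}
    [NormedAddCommGroup E] [InnerProductSpace ℂ E] [FiniteDimensional ℂ E]
    [NormedAddCommGroup F] [InnerProductSpace ℂ F] [FiniteDimensional ℂ F]
    (T : E →ₗ[ℂ] F) {n : ℕ} (hn : Module.finrank ℂ E = n) (x : E) :
    ‖T x‖ ^ 2 = ∑ i : Fin n, T.singularValues i ^ 2 *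
      ‖inner ℂ (T.isSymmetric_adjoint_comp_self.eigenvectorBasis hn i) x‖ ^ 2 := by
  set b := T.isSymmetric_adjoint_comp_self.eigenvectorBasis hn with hb
  have h1 : ((‖T x‖ ^ 2 : ℝ) : ℂ) = inner ℂ x ((LinearMap.adjoint T ∘ₗ T) x) := by
    rw [LinearMap.comp_apply, LinearMap.adjoint_inner_right, inner_self_eq_norm_sq_to_K]
    norm_cast
  have h2 : ∀ i, inner ℂ (b i) ((LinearMap.adjoint T ∘ₗ T) x) =
      ((T.singularValues i ^ 2 : ℝ) : ℂ) * inner ℂ (b i) x := by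
    intro i
    rw [T.sq_singularValues_fin hn, ← T.isSymmetric_adjoint_comp_self (b i) x, hb,
      LinearMap.IsSymmetric.apply_eigenvectorBasis, inner_smul_left]
    simp
  have h3 : ((‖T x‖ ^ 2 : ℝ) : ℂ) = ((∑ i : Fin n, T.singularValues i ^ 2 *
      ‖inner ℂ (b i) x‖ ^ 2 : ℝ) : ℂ) := by
    rw [h1, ← b.sum_inner_mul_inner, Complex.ofReal_sum]
    refine Finset.sum_congr rfl fun i _ => ?_
    rw [h2, mul_left_comm, ← inner_conj_symm x (b i), Complex.conj_mul']
    push_cast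
    rfl
  exact_mod_cast h3

theorem charpoly_adjoint_comp_self {E F : Type*}
    [NormedAddCommGroup E] [InnerProductSpace ℂ E] [FiniteDimensional ℂ E]
    [NormedAddCommGroup F] [InnerProductSpace ℂ F] [FiniteDimensional ℂ F]
    (T : E →ₗ[ℂ] F) {n : ℕ} (hn : Module.finrank ℂ E = n) :
    (LinearMap.adjoint T ∘ₗ T).charpoly =
      ∏ i : Fin n, (Polynomial.X - Polynomial.C ((T.singularValues i ^ 2 : ℝ) : ℂ)) := by
  simp_rw [T.sq_singularValues_fin hn]
  exact T.isSymmetric_adjoint_comp_self.charpoly_eq hn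

section SingVal

variable {a b : ℕ}

theorem singVal_nonneg (M : Matrix (Fin a) (Fin b) ℂ) (i : ℕ) : 0 ≤ singVal M i :=
  LinearMap.singularValues_nonneg _ _

theorem singVal_antitone (M : Matrix (Fin a) (Fin b) ℂ) : Antitone (singVal M) :=
  LinearMap.singularValues_antitone _

theorem norm_toEuclideanLin_le (M : Matrix (Fin a) (Fin b) ℂ) (x : EuclideanSpace ℂ (Fin b)) :
    ‖Matrix.toEuclideanLin M x‖ ≤ singVal M 0 * ‖x‖ := by
  refine le_of_sq_le_sq ?_ (mul_nonneg (singVal_nonneg _ _) (norm_nonneg _))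
  rw [norm_sq_eq_sum_singularValues _ finrank_euclideanSpace_fin, mul_pow,
    ← (LinearMap.isSymmetric_adjoint_comp_self (Matrix.toEuclideanLin M)).eigenvectorBasis
      finrank_euclideanSpace_fin |>.sum_sq_norm_inner_right x, Finset.mul_sum]
  gcongr with i
  · exact LinearMap.singularValues_nonneg _ _
  · exact singVal_antitone M (Nat.zero_le _)

/-- This turns `β ≤ σ_min` into inequalities, one for each vector, that are closed conditions on the
matrix. Continuity of the smallest singular value is then not needed. -/
theorem sigmaMin_mul_norm_le {r : ℕ} (M : Matrix (Fin r) (Fin r) ℂ)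
    (x : EuclideanSpace ℂ (Fin r)) :
    sigmaMin M * ‖x‖ ≤ ‖Matrix.toEuclideanLin M x‖ := by
  refine le_of_sq_le_sq ?_ (norm_nonneg _)
  rw [norm_sq_eq_sum_singularValues _ finrank_euclideanSpace_fin, mul_pow,
    ← (LinearMap.isSymmetric_adjoint_comp_self (Matrix.toEuclideanLin M)).eigenvectorBasis
      finrank_euclideanSpace_fin |>.sum_sq_norm_inner_right x, Finset.mul_sum]
  gcongr with i
  · exact singVal_nonneg _ _
  · exact singVal_antitone M (by omega)

/-- The bound is attained at the first eigenvector of `M* M`. The identity yields continuity of the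
largest singular value, simple or not. -/
theorem singVal_zero_eq_norm (M : Matrix (Fin a) (Fin b) ℂ) :
    singVal M 0 = ‖LinearMap.toContinuousLinearMap (Matrix.toEuclideanLin M)‖ := by
  refine le_antisymm ?_ (ContinuousLinearMap.opNorm_le_bound _ (singVal_nonneg _ _)
    (norm_toEuclideanLin_le M))
  rcases Nat.eq_zero_or_pos b with rfl | hb
  · have : singVal M 0 = 0 :=
      LinearMap.singularValues_of_finrank_le _ (by simp)
    rw [this]
    positivity
  · set v := (LinearMap.isSymmetric_adjoint_comp_self (Matrix.toEuclideanLin M)).eigenvectorBasis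
      finrank_euclideanSpace_fin with hv
    have h1 : ‖Matrix.toEuclideanLin M (v ⟨0, hb⟩)‖ ^ 2 = singVal M 0 ^ 2 := by
      rw [norm_sq_eq_sum_singularValues _ finrank_euclideanSpace_fin,
        Finset.sum_eq_single ⟨0, hb⟩]
      · rw [← hv, inner_self_eq_norm_sq_to_K, v.norm_eq_one]
        simp [singVal]
      · intro i _ hi
        rw [← hv, v.inner_eq_zero hi]
        simp
      · simp
    have h2 := (LinearMap.toContinuousLinearMap (Matrix.toEuclideanLin M)).le_opNorm (v ⟨0, hb⟩)
    rw [v.norm_eq_one, mul_one] at h2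
    rwa [← (sq_eq_sq₀ (norm_nonneg _) (singVal_nonneg _ _)).1 h1]

theorem continuous_singVal_zero :
    Continuous fun M : Matrix (Fin a) (Fin b) ℂ => singVal M 0 := by
  simp_rw [singVal_zero_eq_norm]
  exact ((LinearMap.toContinuousLinearMap.toLinearMap ∘ₗ
    (Matrix.toEuclideanLin (𝕜 := ℂ) (m := Fin a) (n := Fin b)).toLinearMap
      ).continuous_of_finiteDimensional).norm

theorem charpoly_conjTranspose_mul_self (M : Matrix (Fin a) (Fin b) ℂ) :
    (Mᴴ * M).charpoly =
      ∏ i : Fin b, (Polynomial.X - Polynomial.C ((singVal M i ^ 2 : ℝ) : ℂ)) := by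
  have h1 : LinearMap.adjoint (Matrix.toEuclideanLin M) ∘ₗ Matrix.toEuclideanLin M =
      Matrix.toEuclideanLin (Mᴴ * M) := by
    rw [← Matrix.toEuclideanLin_conjTranspose_eq_adjoint]
    ext x i
    simp [Matrix.mulVec_mulVec]
  have h2 : (Matrix.toEuclideanLin (Mᴴ * M)).charpoly = (Mᴴ * M).charpoly := by
    rw [Matrix.toEuclideanLin_eq_toLin_orthonormal, Matrix.charpoly_toLin]
  rw [← h2, ← h1]
  exact charpoly_adjoint_comp_self _ finrank_euclideanSpace_fin

theorem det_scalar_sub_conjTranspose_mul_self (M : Matrix (Fin a) (Fin b) ℂ) (t : ℝ) :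
    (Matrix.scalar (Fin b) (t : ℂ) - Mᴴ * M).det =
      ((∏ i : Fin b, (t - singVal M i ^ 2) : ℝ) : ℂ) := by
  rw [← Matrix.eval_charpoly, charpoly_conjTranspose_mul_self, Polynomial.eval_prod]
  simp

end SingVal

/-! ### Smoothness of matrix operations -/

section MatrixSmooth

variable {X : Type*} [NormedAddCommGroup X] [NormedSpace ℝ X] {N : WithTop ENat} {x : X}
  {α β γ : Type*} [Fintype α] [Fintype β] [Fintype γ]

theorem contDiffAt_matrix_iff {f : X → Matrix α β ℂ} :
    ContDiffAt ℝ N f x ↔ ∀ i j, ContDiffAt ℝ N (fun y => f y i j) x := by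
  refine ⟨fun h i j => ?_, fun h => ?_⟩
  · exact contDiffAt_pi.1 (contDiffAt_pi.1 h i) j
  · exact contDiffAt_pi.2 fun i => contDiffAt_pi.2 (h i)

theorem ContDiffAt.matrix_mul {f : X → Matrix α β ℂ} {g : X → Matrix β γ ℂ}
    (hf : ContDiffAt ℝ N f x) (hg : ContDiffAt ℝ N g x) :
    ContDiffAt ℝ N (fun y => f y * g y) x := by
  rw [contDiffAt_matrix_iff] at *
  intro i j
  simp only [Matrix.mul_apply]
  exact ContDiffAt.sum fun k _ => (hf i k).mul (hg k j)

theorem ContDiffAt.matrix_conjTranspose {f : X → Matrix α β ℂ} (hf : ContDiffAt ℝ N f x) :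
    ContDiffAt ℝ N (fun y => (f y)ᴴ) x := by
  rw [contDiffAt_matrix_iff] at *
  intro i j
  exact Complex.conjCLE.contDiff.contDiffAt.comp x (hf j i)

variable [DecidableEq α]

theorem ContDiffAt.matrix_det {f : X → Matrix α α ℂ} (hf : ContDiffAt ℝ N f x) :
    ContDiffAt ℝ N (fun y => (f y).det) x := by
  rw [contDiffAt_matrix_iff] at hf
  simp only [Matrix.det_apply']
  exact ContDiffAt.sum fun σ _ => contDiffAt_const.mul (contDiffAt_prod fun i _ => hf _ _)

theorem ContDiffAt.matrix_inv {f : X → Matrix α α ℂ} (hf : ContDiffAt ℝ N f x)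
    (h0 : (f x).det ≠ 0) : ContDiffAt ℝ N (fun y => (f y)⁻¹) x := by
  have hdet := hf.matrix_det
  rw [contDiffAt_matrix_iff] at *
  intro i j
  -- By Cramer's rule each entry of the inverse is a quotient of determinants.
  simp only [Matrix.inv_def, Ring.inverse_eq_inv', Matrix.smul_apply, smul_eq_mul]
  refine (hdet.inv h0).mul ?_
  simp only [Matrix.adjugate_apply]
  refine ContDiffAt.matrix_det (contDiffAt_matrix_iff.2 fun k l => ?_)
  by_cases hk : k = j
  · subst hk
    simp only [Matrix.updateRow_self]
    exact contDiffAt_const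
  · simp only [Matrix.updateRow_ne hk]
    exact hf k l

end MatrixSmooth

/-! ### Smoothness of a simple largest singular value -/

/-- A continuous solution `φ` of `g (x, φ x) = 0` is as smooth as `g` where the partial derivative
of `g` in the last variable does not vanish. -/
theorem contDiffAt_of_implicit_eq {X : Type*} [NormedAddCommGroup X] [NormedSpace ℝ X]
    [CompleteSpace X] {N : WithTop ENat} (hN : N ≠ 0) {g : X × ℝ → ℝ} {φ : X → ℝ} {x₀ : X} {c : ℝ}
    (hg : ContDiffAt ℝ N g (x₀, φ x₀)) (hderiv : HasDerivAt (fun t => g (x₀, t)) c (φ x₀))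
    (hc : c ≠ 0) (hφ : ContinuousAt φ x₀) (hroot : ∀ x, g (x, φ x) = 0) :
    ContDiffAt ℝ N φ x₀ := by
  have hpartial : (fderiv ℝ g (x₀, φ x₀) ∘L .inr ℝ X ℝ) 1 = c :=
    ((hg.differentiableAt hN).hasFDerivAt.comp_hasDerivAt (φ x₀)
      ((hasDerivAt_const (φ x₀) x₀).prodMk (hasDerivAt_id (φ x₀)))).unique hderiv
  have hinv : (fderiv ℝ g (x₀, φ x₀) ∘L .inr ℝ X ℝ).IsInvertible := by
    refine ⟨ContinuousLinearEquiv.unitsEquivAut ℝ (Units.mk0 _ hc), ?_⟩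
    ext
    simp [← hpartial]
  refine (hg.contDiffAt_implicitFunction hN hinv).congr_of_eventuallyEq ?_
  -- Continuity of `φ` keeps `(x, φ x)` in the neighbourhood where the implicit function is the only
  -- solution.
  filter_upwards [(continuousAt_id.prodMk hφ).eventually
    (hg.eventually_apply_eq_iff_implicitFunction hN hinv)] with x hx
  exact (hx.1 ((hroot x).trans (hroot x₀).symm)).symm

/-- The largest singular value depends smoothly on the matrix where it is simple. -/
theorem contDiffAt_singVal_zero {a b : ℕ} {N : WithTop ENat} (hN : N ≠ 0)
    {M₀ : Matrix (Fin a) (Fin b) ℂ}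
    (h : singVal M₀ 1 < singVal M₀ 0) :
    ContDiffAt ℝ N (fun M : Matrix (Fin a) (Fin b) ℂ => singVal M 0) M₀ := by
  have hpos : 0 < singVal M₀ 0 := (singVal_nonneg _ _).trans_lt h
  have hb : 0 < b := by
    by_contra hb
    exact hpos.ne' (LinearMap.singularValues_of_finrank_le _ (by simp; omega))
  set t₀ : ℝ := singVal M₀ 0 ^ 2 with ht₀
  -- The characteristic polynomial of `M* M` at `t`. It is real for real `t`, has the root `singVal
  -- M 0 ^ 2` for every `M`, and this root is simple at `M₀`.
  let g : Matrix (Fin a) (Fin b) ℂ × ℝ → ℝ :=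
    fun z => (Matrix.scalar (Fin b) (z.2 : ℂ) - z.1ᴴ * z.1).det.re
  have hg : ∀ M t, g (M, t) = ∏ i : Fin b, (t - singVal M i ^ 2) := fun M t => by
    simp only [g, det_scalar_sub_conjTranspose_mul_self, Complex.ofReal_re]
  have hroot : ∀ M, g (M, singVal M 0 ^ 2) = 0 := fun M => by
    rw [hg]
    exact Finset.prod_eq_zero (Finset.mem_univ ⟨0, hb⟩) (sub_self _)
  have hsmooth : ContDiffAt ℝ N g (M₀, t₀) := by
    refine Complex.reCLM.contDiff.contDiffAt.comp _ (ContDiffAt.matrix_det (ContDiffAt.sub ?_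
      (ContDiffAt.matrix_mul contDiffAt_fst.matrix_conjTranspose contDiffAt_fst)))
    refine contDiffAt_matrix_iff.2 fun i j => ?_
    by_cases hij : i = j
    · subst hij
      simp only [Matrix.scalar_apply, Matrix.diagonal_apply_eq]
      exact Complex.ofRealCLM.contDiff.contDiffAt.comp (M₀, t₀) contDiffAt_snd
    · simpa [hij] using contDiffAt_const
  have hderiv : HasDerivAt (fun t => g (M₀, t))
      (∏ i ∈ Finset.univ.erase (⟨0, hb⟩ : Fin b), (t₀ - singVal M₀ i ^ 2)) t₀ := by
    have hQ : DifferentiableAt ℝ (fun t : ℝ => ∏ i ∈ Finset.univ.erase (⟨0, hb⟩ : Fin b),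
        (t - singVal M₀ i ^ 2)) t₀ := by fun_prop
    have hprod : (fun t => g (M₀, t)) = fun t => (t - t₀) *
        ∏ i ∈ Finset.univ.erase (⟨0, hb⟩ : Fin b), (t - singVal M₀ i ^ 2) := by
      funext t
      rw [hg, ← Finset.mul_prod_erase _ _ (Finset.mem_univ (⟨0, hb⟩ : Fin b))]
    rw [hprod]
    simpa using ((hasDerivAt_id t₀).sub_const t₀).fun_mul hQ.hasDerivAt
  have hne : ∏ i ∈ Finset.univ.erase (⟨0, hb⟩ : Fin b), (t₀ - singVal M₀ i ^ 2) ≠ 0 := by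
    refine Finset.prod_ne_zero_iff.2 fun i hi => ?_
    have hi1 : 1 ≤ (i : ℕ) := by
      have := Finset.ne_of_mem_erase hi
      rw [Ne, Fin.ext_iff] at this
      simp at this
      omega
    have := (singVal_antitone M₀ hi1).trans_lt h
    exact (sub_pos.2 (pow_lt_pow_left₀ this (singVal_nonneg _ _) two_ne_zero)).ne'
  have hsq : ContDiffAt ℝ N (fun M : Matrix (Fin a) (Fin b) ℂ => singVal M 0 ^ 2) M₀ :=
    contDiffAt_of_implicit_eq hN hsmooth hderiv hne
      (continuous_singVal_zero.pow 2).continuousAt hroot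
  -- The square root is smooth here because `singVal M₀ 0` is positive.
  refine (hsq.sqrt (pow_pos hpos 2).ne').congr_of_eventuallyEq (Eventually.of_forall fun M => ?_)
  exact (Real.sqrt_sq (singVal_nonneg M 0)).symm

/-! ### Derivative bounds uniform over a compact parameter set -/

theorem ContDiffAt.lineDeriv_const {X : Type*} [NormedAddCommGroup X] [NormedSpace ℝ X]
    {f : X → ℝ} {x : X} {l : ℕ} (hf : ContDiffAt ℝ (l + 1) f x) (v : X) :
    ContDiffAt ℝ l (fun y => lineDeriv ℝ f y v) x := by
  refine (hf.fderiv_right_succ.clm_apply (contDiffAt_const (c := v))).congr_of_eventuallyEq ?_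
  have hev : ∀ᶠ y in 𝓝 x, ContDiffAt ℝ (l + 1) f y :=
    hf.eventually (by exact_mod_cast WithTop.coe_ne_top)
  filter_upwards [hev] with y hy
  exact (hy.differentiableAt (by simp)).lineDeriv_eq_fderiv

/-- Freezing `q` commutes with differentiating in `x`. Iterated partial derivatives are thus slices
of functions continuous in `(x, q)` jointly, which compactness can bound. -/
theorem partialDeriv_slice {d : ℕ} {Q : Type*} [NormedAddCommGroup Q] [NormedSpace ℝ Q]
    (Φ : (Param d × ℝ) × Q → ℝ) (q : Q) (χ : Option (Fin d)) :
    partialDeriv χ (fun x => Φ (x, q)) = fun x => lineDeriv ℝ Φ (x, q) (coordDir χ, 0) := by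
  funext x
  simp [partialDeriv, lineDeriv]

theorem exists_bound_on_closedBall_prod {X Q : Type*} [PseudoMetricSpace X] [ProperSpace X]
    [TopologicalSpace Q] {𝒦 : Set Q} (h𝒦 : IsCompact 𝒦) {x₀ : X} {η : ℝ} {F : X × Q → ℝ}
    (hF : ∀ z ∈ Metric.closedBall x₀ η ×ˢ 𝒦, ContinuousAt F z) :
    ∃ U, ∀ z ∈ Metric.closedBall x₀ η ×ˢ 𝒦, |F z| ≤ U :=
  ((isCompact_closedBall x₀ η).prod h𝒦).exists_bound_of_continuousOn
    fun z hz => (hF z hz).continuousWithinAt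

/-- A family of functions depending three times continuously differentiably on its variable and
on a parameter has partial derivatives bounded uniformly for parameters in a compact set. -/
theorem exists_uniform_partialDeriv_bound {d : ℕ} {Q : Type*} [NormedAddCommGroup Q]
    [NormedSpace ℝ Q] {Φ : (Param d × ℝ) × Q → ℝ} {x₀ : Param d × ℝ} {𝒦 : Set Q}
    (h𝒦 : IsCompact 𝒦) (hΦ : ∀ q ∈ 𝒦, ContDiffAt ℝ 3 Φ (x₀, q)) :
    ∃ U η : ℝ, 0 < η ∧ ∀ x ∈ Metric.closedBall x₀ η, ∀ q ∈ 𝒦,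
      ContDiffAt ℝ 3 (fun y => Φ (y, q)) x ∧
      ∀ χ₁ χ₂ χ₃ : Option (Fin d),
        |partialDeriv χ₁ (fun y => Φ (y, q)) x| ≤ U ∧
        |partialDeriv χ₂ (partialDeriv χ₁ (fun y => Φ (y, q))) x| ≤ U ∧
        |partialDeriv χ₃ (partialDeriv χ₂ (partialDeriv χ₁ (fun y => Φ (y, q)))) x| ≤ U := by
  have h1 : ∀ᶠ x in 𝓝 x₀, ∀ q ∈ 𝒦, ContDiffAt ℝ 3 Φ (x, q) :=
    h𝒦.eventually_forall_of_forall_eventually fun q hq => (hΦ q hq).eventually (by simp)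
  obtain ⟨η, hη, hball⟩ := Metric.nhds_basis_closedBall.eventually_iff.1 h1
  -- The order `3` is written as a successor, since each directional derivative uses up one.
  have hsm : ∀ z ∈ Metric.closedBall x₀ η ×ˢ 𝒦, ContDiffAt ℝ ((2 : ℕ) + 1) Φ z := fun z hz => by
    have := hball hz.1 z.2 hz.2
    norm_num
    exact this
  let v : Option (Fin d) → (Param d × ℝ) × Q := fun χ => (coordDir χ, 0)
  let Φ₁ : Option (Fin d) → (Param d × ℝ) × Q → ℝ := fun χ₁ z => lineDeriv ℝ Φ z (v χ₁)
  let Φ₂ : Option (Fin d) → Option (Fin d) → (Param d × ℝ) × Q → ℝ :=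
    fun χ₁ χ₂ z => lineDeriv ℝ (Φ₁ χ₁) z (v χ₂)
  let Φ₃ : Option (Fin d) → Option (Fin d) → Option (Fin d) → (Param d × ℝ) × Q → ℝ :=
    fun χ₁ χ₂ χ₃ z => lineDeriv ℝ (Φ₂ χ₁ χ₂) z (v χ₃)
  have hs₁ : ∀ χ₁, ∀ z ∈ Metric.closedBall x₀ η ×ˢ 𝒦, ContDiffAt ℝ ((1 : ℕ) + 1) (Φ₁ χ₁) z :=
    fun χ₁ z hz => by
      have := (hsm z hz).lineDeriv_const (v χ₁)
      norm_num at this ⊢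
      exact this
  have hs₂ : ∀ χ₁ χ₂, ∀ z ∈ Metric.closedBall x₀ η ×ˢ 𝒦,
      ContDiffAt ℝ ((0 : ℕ) + 1) (Φ₂ χ₁ χ₂) z := fun χ₁ χ₂ z hz => by
    have := (hs₁ χ₁ z hz).lineDeriv_const (v χ₂)
    norm_num at this ⊢
    exact this
  have hs₃ : ∀ χ₁ χ₂ χ₃, ∀ z ∈ Metric.closedBall x₀ η ×ˢ 𝒦,
      ContDiffAt ℝ (0 : ℕ) (Φ₃ χ₁ χ₂ χ₃) z := fun χ₁ χ₂ χ₃ z hz =>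
    (hs₂ χ₁ χ₂ z hz).lineDeriv_const (v χ₃)
  choose U₁ hU₁ using fun χ₁ => exists_bound_on_closedBall_prod h𝒦
    fun z hz => (hs₁ χ₁ z hz).continuousAt
  choose U₂ hU₂ using fun χ₁ χ₂ => exists_bound_on_closedBall_prod h𝒦
    fun z hz => (hs₂ χ₁ χ₂ z hz).continuousAt
  choose U₃ hU₃ using fun χ₁ χ₂ χ₃ => exists_bound_on_closedBall_prod h𝒦
    fun z hz => (hs₃ χ₁ χ₂ χ₃ z hz).continuousAt
  obtain ⟨⟨a, b, c⟩, hmax⟩ := Finite.exists_max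
    fun χ : Option (Fin d) × Option (Fin d) × Option (Fin d) =>
      max (U₁ χ.1) (max (U₂ χ.1 χ.2.1) (U₃ χ.1 χ.2.1 χ.2.2))
  refine ⟨max (U₁ a) (max (U₂ a b) (U₃ a b c)), η, hη, fun x hx q hq => ⟨?_, fun χ₁ χ₂ χ₃ => ?_⟩⟩
  · exact (hball hx q hq).comp x (contDiffAt_id.prodMk contDiffAt_const)
  · have hm := hmax (χ₁, χ₂, χ₃)
    have e₁ : partialDeriv χ₁ (fun y => Φ (y, q)) = fun y => Φ₁ χ₁ (y, q) :=
      partialDeriv_slice Φ q χ₁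
    have e₂ : partialDeriv χ₂ (fun y => Φ₁ χ₁ (y, q)) = fun y => Φ₂ χ₁ χ₂ (y, q) :=
      partialDeriv_slice (Φ₁ χ₁) q χ₂
    have e₃ : partialDeriv χ₃ (fun y => Φ₂ χ₁ χ₂ (y, q)) = fun y => Φ₃ χ₁ χ₂ χ₃ (y, q) :=
      partialDeriv_slice (Φ₂ χ₁ χ₂) q χ₃
    rw [e₁, e₂, e₃]
    rw [max_le_iff, max_le_iff] at hm
    exact ⟨(hU₁ χ₁ (x, q) ⟨hx, hq⟩).trans hm.1,
      (hU₂ χ₁ χ₂ (x, q) ⟨hx, hq⟩).trans hm.2.1,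
      (hU₃ χ₁ χ₂ χ₃ (x, q) ⟨hx, hq⟩).trans hm.2.2⟩

/-! ### Column spaces and nonsingularity -/

theorem exists_eq_mul_of_colSpace_le {a b c : ℕ} {X : Matrix (Fin a) (Fin b) ℂ}
    {V : Matrix (Fin a) (Fin c) ℂ} (h : colSpace X ≤ colSpace V) :
    ∃ Y : Matrix (Fin c) (Fin b) ℂ, X = V * Y := by
  have h1 : ∀ j, ∃ y, V *ᵥ y = X.col j := fun j => by
    have : X.col j ∈ colSpace X := ⟨Pi.single j 1, by simp⟩
    exact h this
  choose y hy using h1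
  refine ⟨Matrix.of fun i j => y j i, ?_⟩
  ext i j
  exact (congrFun (hy j) i).symm

theorem det_ne_zero_of_mul_norm_le {r : ℕ} {M : Matrix (Fin r) (Fin r) ℂ} {β : ℝ} (hβ : 0 < β)
    (h : ∀ x, β * ‖x‖ ≤ ‖Matrix.toEuclideanLin M x‖) : M.det ≠ 0 := by
  intro h0
  obtain ⟨v, hv, hMv⟩ := Matrix.exists_mulVec_eq_zero_iff.2 h0
  have h1 := h (WithLp.toLp 2 v)
  have h2 : Matrix.toEuclideanLin M (WithLp.toLp 2 v) = 0 := by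
    rw [Matrix.toLpLin_toLp, Matrix.toLin'_apply, hMv]
    rfl
  rw [h2, norm_zero] at h1
  have h3 : ‖WithLp.toLp 2 v‖ = 0 :=
    le_antisymm (nonpos_of_mul_nonpos_right h1 hβ) (norm_nonneg _)
  exact hv (by simpa using h3)

/-! ### Localization of the maximizing frequencies -/

namespace StateSpace

variable {d r m p : ℕ} (G : StateSpace d r m p)

theorem continuous_Di (μ : Param d) : Continuous (G.Di μ) := by
  unfold Di D
  fun_prop

theorem continuousAt_sigma (μ : Param d) {ω : ℝ} (h : (G.Di μ ω).det ≠ 0) :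
    ContinuousAt (G.sigma μ) ω := by
  refine continuous_singVal_zero.continuousAt.comp (x := ω) ?_
  have h1 : ContinuousAt (fun ω => (G.Di μ ω)⁻¹) ω := by
    simp only [Matrix.inv_def, Ring.inverse_eq_inv']
    exact ((G.continuous_Di μ).matrix_det.continuousAt.inv₀ h).smul
      (G.continuous_Di μ).matrix_adjugate.continuousAt
  exact ((continuous_const.matrix_mul continuous_id).matrix_mul
    continuous_const).continuousAt.comp h1

theorem sigmaExt_coe (μ : Param d) {ω : ℝ} (h : (G.Di μ ω).det ≠ 0) :
    G.sigmaExt μ (ω : OnePoint ℝ) = G.sigma μ ω :=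
  ((G.continuousAt_sigma μ h).tendsto.mono_left nhdsWithin_le_nhds).limUnder_eq

/-- If the largest singular value at `μ₀` has a unique global maximizer up to sign, then the
maximizers at nearby parameters are close to it up to sign. -/
theorem eventually_isMaxFreq_near {K : Set (Param d)} {μ₀ : Param d} {ω₀ : ℝ}
    (hsmooth : G.Smooth μ₀ ω₀)
    (hcont : ∀ ω : OnePoint ℝ, ContinuousWithinAt
      (fun x : Param d × OnePoint ℝ => G.sigmaExt x.1 x.2) (K ×ˢ Set.univ) (μ₀, ω))
    (hdet : ∀ᶠ μ in 𝓝 μ₀, (G.Di μ ω₀).det ≠ 0) {ε : ℝ} (hε : 0 < ε) :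
    ∀ᶠ μ in 𝓝 μ₀, μ ∈ K → ∀ ω, G.IsMaxFreq μ ω → |ω - ω₀| < ε ∨ |ω + ω₀| < ε := by
  -- `F` is compact because `ℝ ∪ {∞}` is; including `∞` prevents maximizers from escaping to
  -- infinity.
  set F : Set (OnePoint ℝ) :=
    ((↑) '' (Metric.ball ω₀ ε ∪ Metric.ball (-ω₀) ε) : Set (OnePoint ℝ))ᶜ with hFdef
  have hF : IsCompact F := by
    refine (IsOpen.isClosed_compl ?_).isCompact
    exact OnePoint.isOpenEmbedding_coe.isOpenMap _ (Metric.isOpen_ball.union Metric.isOpen_ball)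
  have h1 : Tendsto (fun μ => G.sigmaExt μ (ω₀ : OnePoint ℝ)) (𝓝[K] μ₀)
      (𝓝 (G.sigma μ₀ ω₀)) := by
    rw [← G.sigmaExt_coe μ₀ hdet.self_of_nhds]
    refine Tendsto.comp (f := fun μ => (μ, (ω₀ : OnePoint ℝ))) (hcont ω₀).tendsto (tendsto_nhdsWithin_iff.2 ⟨?_, ?_⟩)
    · exact (Continuous.prodMk_left _).continuousAt.tendsto.mono_left nhdsWithin_le_nhds
    · exact eventually_mem_nhdsWithin.mono fun μ hμ => ⟨hμ, Set.mem_univ _⟩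
  -- The strict inequality at `μ₀` persists near each `ω ∈ F`, hence uniformly on `F` by
  -- compactness.
  have h2 : ∀ᶠ μ in 𝓝 μ₀, ∀ ω ∈ F, μ ∈ K → G.sigmaExt μ ω < G.sigmaExt μ (ω₀ : OnePoint ℝ) := by
    refine hF.eventually_forall_of_forall_eventually fun ω hω => ?_
    have hlt : G.sigmaExt μ₀ ω < G.sigma μ₀ ω₀ := by
      refine hsmooth.1 ω ?_ ?_
      · rintro rfl
        exact hω ⟨ω₀, Or.inl (Metric.mem_ball_self hε), rfl⟩
      · rintro rfl
        exact hω ⟨-ω₀, Or.inr (Metric.mem_ball_self hε), rfl⟩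
    have h3 : Tendsto (fun z : Param d × OnePoint ℝ => z.1) (𝓝[K ×ˢ Set.univ] (μ₀, ω))
        (𝓝[K] μ₀) :=
      tendsto_nhdsWithin_iff.2 ⟨continuousAt_fst.tendsto.mono_left nhdsWithin_le_nhds,
        eventually_mem_nhdsWithin.mono fun z hz => hz.1⟩
    have h4 := (hcont ω).tendsto.eventually_lt (h1.comp h3) hlt
    filter_upwards [eventually_nhdsWithin_iff.1 h4] with z hz hzK
    exact hz ⟨hzK, Set.mem_univ _⟩
  filter_upwards [h2, hdet] with μ hμ hμdet hμK ω hω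
  by_contra hcon
  have hωF : (ω : OnePoint ℝ) ∈ F := by
    rintro ⟨ω', hω', he⟩
    rw [OnePoint.coe_eq_coe] at he
    subst he
    refine hcon (hω'.imp (fun h => ?_) fun h => ?_)
    · rwa [Metric.mem_ball, Real.dist_eq] at h
    · rwa [Metric.mem_ball, Real.dist_eq, sub_neg_eq_add] at h
  have := hμ _ hωF hμK
  rw [G.sigmaExt_coe μ hω.1, G.sigmaExt_coe μ hμdet] at this
  exact this.not_ge (hω.2 _ hμdet)

end StateSpace

/-! ### The reduced transfer function and interpolation -/

namespace ParamSystem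

variable {d n m p : ℕ} (S : ParamSystem d n m p)

theorem reduced_Di {r : ℕ} (V W : Matrix (Fin n) (Fin r) ℂ) (μ : Param d) (ω : ℝ) :
    (S.reduced V W).Di μ ω = Wᴴ * S.full.Di μ ω * V := by
  simp [StateSpace.Di, StateSpace.D, reduced, full, Matrix.mul_sub, Matrix.sub_mul,
    Matrix.mul_sum, Matrix.sum_mul]

theorem reduced_Hi {r : ℕ} (V W : Matrix (Fin n) (Fin r) ℂ) (μ : Param d) (ω : ℝ) :
    (S.reduced V W).Hi μ ω =
      S.full.C μ * V * (Wᴴ * S.full.Di μ ω * V)⁻¹ * (Wᴴ * S.full.B μ) := by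
  have hB : (S.reduced V W).B μ = Wᴴ * S.full.B μ := by
    simp [reduced, full, Matrix.mul_sum]
  have hC : (S.reduced V W).C μ = S.full.C μ * V := by
    simp [reduced, full, Matrix.sum_mul]
  rw [← reduced_Di, ← hB, ← hC]
  rfl

/-- One-sided tangential interpolation: the transfer function of the reduced system agrees with
that of the full system at a point for which the projection spaces have been enlarged. -/
theorem reduced_Hi_eq {r : ℕ} {V W : Matrix (Fin n) (Fin r) ℂ} {μ : Param d} {ω : ℝ}
    (hfull : (S.full.Di μ ω).det ≠ 0) (hred : ((S.reduced V W).Di μ ω).det ≠ 0)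
    (hV : S.full.expandV μ ω ≤ colSpace V) (hW : S.full.expandW μ ω ≤ colSpace W) :
    (S.reduced V W).Hi μ ω = S.full.Hi μ ω := by
  rw [reduced_Di] at hred
  rw [reduced_Hi]
  change _ = S.full.C μ * (S.full.Di μ ω)⁻¹ * S.full.B μ
  set D := S.full.Di μ ω
  have hD : IsUnit D.det := isUnit_iff_ne_zero.2 hfull
  have hR : IsUnit (Wᴴ * D * V).det := isUnit_iff_ne_zero.2 hred
  rcases le_total m p with hmp | hmp
  · rw [StateSpace.expandV, if_pos hmp] at hV
    obtain ⟨Y, hY⟩ := exists_eq_mul_of_colSpace_le hV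
    -- Since `D⁻¹ B = V Y`, the reduced equation with right-hand side `W* B` has the solution `Y`,
    -- and `C V Y = C D⁻¹ B`. The other case is dual, so one of the two spaces always suffices.
    have hB : S.full.B μ = D * (V * Y) := by
      rw [← hY, Matrix.mul_nonsing_inv_cancel_left _ _ hD]
    have h1 : Wᴴ * S.full.B μ = Wᴴ * D * V * Y := by
      rw [hB]
      simp only [Matrix.mul_assoc]
    rw [h1, Matrix.mul_assoc, Matrix.nonsing_inv_mul_cancel_left _ _ hR, Matrix.mul_assoc,
      ← hY, Matrix.mul_assoc]
  · rw [StateSpace.expandW, if_pos hmp] at hW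
    obtain ⟨Y, hY⟩ := exists_eq_mul_of_colSpace_le hW
    have hY' : S.full.C μ * D⁻¹ = Yᴴ * Wᴴ := by
      have := congrArg Matrix.conjTranspose hY
      simpa [Matrix.conjTranspose_mul] using this
    have hC : S.full.C μ = Yᴴ * Wᴴ * D := by
      rw [← hY', Matrix.nonsing_inv_mul_cancel_right _ _ hD]
    have h1 : S.full.C μ * V = Yᴴ * (Wᴴ * D * V) := by
      rw [hC]
      simp only [Matrix.mul_assoc]
    rw [h1, Matrix.mul_nonsing_inv_cancel_right _ _ hR, hY', Matrix.mul_assoc]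

section Smoothness

variable {X : Type*} [NormedAddCommGroup X] [NormedSpace ℝ X] {N : WithTop ENat} {x : X}

theorem contDiffAt_sum_smul_toC {a b κ : ℕ} {c : Fin κ → Param d → ℝ} {Ω : Set (Param d)}
    (hc : ∀ i, AnalyticOnNhd ℝ (c i) Ω) (M : Fin κ → Matrix (Fin a) (Fin b) ℝ)
    {u : X → Param d} (hu : ContDiffAt ℝ N u x) (hux : u x ∈ Ω) :
    ContDiffAt ℝ N (fun y => ∑ i, (c i (u y) : ℂ) • toC (M i)) x := by
  refine ContDiffAt.sum fun i _ => ContDiffAt.fun_smul ?_ contDiffAt_const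
  exact Complex.ofRealCLM.contDiff.contDiffAt.comp x ((hc i _ hux).contDiffAt.comp x hu)

theorem contDiffAt_full_Di {u : X → Param d} {w : X → ℝ} (hu : ContDiffAt ℝ N u x)
    (hw : ContDiffAt ℝ N w x) (hux : u x ∈ S.Ω) :
    ContDiffAt ℝ N (fun y => S.full.Di (u y) (w y)) x := by
  refine ContDiffAt.sub (ContDiffAt.fun_smul (contDiffAt_const.mul ?_)
    (contDiffAt_sum_smul_toC S.analytic_f S.E hu hux))
    (contDiffAt_sum_smul_toC S.analytic_g S.A hu hux)
  exact Complex.ofRealCLM.contDiff.contDiffAt.comp x hw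

end Smoothness

end ParamSystem

/-! ### Uniform smoothness of the reduced singular values -/

/-- A compactly parametrized family of matrix functions has largest singular values that are smooth
with uniformly bounded partial derivatives near `x₀`, for all parameters at which the family comes
close to a fixed matrix with a simple largest singular value. -/
theorem exists_uniform_bound_singVal_zero {d m p : ℕ} {Q : Type*} [NormedAddCommGroup Q]
    [NormedSpace ℝ Q] {x₀ : Param d × ℝ} {𝒦 : Set Q} (h𝒦 : IsCompact 𝒦)
    {𝓗 : (Param d × ℝ) × Q → Matrix (Fin p) (Fin m) ℂ} (hH : ∀ q ∈ 𝒦, ContDiffAt ℝ 3 𝓗 (x₀, q))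
    {H₀ : Matrix (Fin p) (Fin m) ℂ} (hH₀ : singVal H₀ 1 < singVal H₀ 0) :
    ∃ U η : ℝ, 0 < η ∧ ∀ q ∈ 𝒦, (∃ x ∈ Metric.closedBall x₀ η, ‖𝓗 (x, q) - H₀‖ ≤ η) →
      ∀ x ∈ Metric.closedBall x₀ η, ContDiffAt ℝ 3 (fun y => singVal (𝓗 (y, q)) 0) x ∧
        ∀ χ₁ χ₂ χ₃ : Option (Fin d),
          |partialDeriv χ₁ (fun y => singVal (𝓗 (y, q)) 0) x| ≤ U ∧
          |partialDeriv χ₂ (partialDeriv χ₁ (fun y => singVal (𝓗 (y, q)) 0)) x| ≤ U ∧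
          |partialDeriv χ₃ (partialDeriv χ₂ (partialDeriv χ₁
            (fun y => singVal (𝓗 (y, q)) 0))) x| ≤ U := by
  have hsing : ∀ᶠ M in 𝓝 H₀,
      ContDiffAt ℝ 3 (fun M : Matrix (Fin p) (Fin m) ℂ => singVal M 0) M :=
    (contDiffAt_singVal_zero (by simp) hH₀).eventually (by simp)
  obtain ⟨ρ, hρ, hsingρ⟩ := Metric.nhds_basis_closedBall.eventually_iff.1 hsing
  have hequi : ∀ᶠ x in 𝓝 x₀, ∀ q ∈ 𝒦, ‖𝓗 (x₀, q) - 𝓗 (x, q)‖ < ρ / 2 := by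
    refine h𝒦.eventually_forall_of_forall_eventually fun q hq => ?_
    have h1 : ContinuousAt (fun z : (Param d × ℝ) × Q => 𝓗 (x₀, z.2)) (x₀, q) :=
      ContinuousAt.comp (g := 𝓗) (f := fun z : (Param d × ℝ) × Q => (x₀, z.2))
        (x := (x₀, q)) (hH q hq).continuousAt (by fun_prop)
    have h2 := (h1.sub (hH q hq).continuousAt).norm
    have h3 : ‖𝓗 (x₀, q) - 𝓗 (x₀, q)‖ < ρ / 2 := by
      rw [sub_self, norm_zero]
      positivity
    exact h2.eventually_lt_const h3
  -- The parameters for which `𝓗 (x₀, q)` lies in the ball where the largest singular value is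
  -- smooth. Half of `ρ` pays for moving from `x` to `x₀`, half for the distance to `H₀` at `x`.
  set 𝒦' := 𝒦 ∩ {q | ‖𝓗 (x₀, q) - H₀‖ ≤ ρ} with h𝒦'def
  have h𝒦' : IsCompact 𝒦' := by
    have hcont : ContinuousOn (fun q => ‖𝓗 (x₀, q) - H₀‖) 𝒦 := fun q hq =>
      (((ContinuousAt.comp (g := 𝓗) (f := fun q => (x₀, q)) (hH q hq).continuousAt
        (by fun_prop)).sub continuousAt_const).norm).continuousWithinAt
    exact h𝒦.of_isClosed_subset (hcont.preimage_isClosed_of_isClosed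
      h𝒦.isClosed isClosed_Iic) Set.inter_subset_left
  obtain ⟨U, η₁, hη₁, hU⟩ := exists_uniform_partialDeriv_bound (x₀ := x₀)
    (Φ := fun z => singVal (𝓗 z) 0) h𝒦'
    fun q hq => (hsingρ (mem_closedBall_iff_norm.2 hq.2)).comp (x₀, q) (hH q hq.1)
  obtain ⟨η₂, hη₂, hball⟩ := Metric.nhds_basis_closedBall.eventually_iff.1 hequi
  refine ⟨U, min η₁ (min η₂ (ρ / 2)), by positivity, ?_⟩
  rintro q hq ⟨y, hy, hyH⟩ x hx
  have h1 := hball (Metric.closedBall_subset_closedBall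
    ((min_le_right _ _).trans (min_le_left _ _)) hy) q hq
  have h2 : ‖𝓗 (y, q) - H₀‖ ≤ ρ / 2 := hyH.trans ((min_le_right _ _).trans (min_le_right _ _))
  have h3 : ‖𝓗 (x₀, q) - H₀‖ ≤ ρ :=
    (norm_sub_le_norm_sub_add_norm_sub _ (𝓗 (y, q)) _).trans (by linarith)
  exact hU x (Metric.closedBall_subset_closedBall (min_le_left _ _) hx) q ⟨hq, h3⟩

namespace ParamSystem

variable {d n m p : ℕ} (S : ParamSystem d n m p)

section Smoothness

variable {X : Type*} [NormedAddCommGroup X] [NormedSpace ℝ X] {N : WithTop ENat} {x : X}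

theorem contDiffAt_reduced_Di {r : ℕ} {u : X → Param d} {w : X → ℝ}
    {V W : X → Matrix (Fin n) (Fin r) ℂ} (hu : ContDiffAt ℝ N u x) (hw : ContDiffAt ℝ N w x)
    (hV : ContDiffAt ℝ N V x) (hW : ContDiffAt ℝ N W x) (hux : u x ∈ S.Ω) :
    ContDiffAt ℝ N (fun y => (S.reduced (V y) (W y)).Di (u y) (w y)) x := by
  simp only [reduced_Di]
  exact (hW.matrix_conjTranspose.matrix_mul (S.contDiffAt_full_Di hu hw hux)).matrix_mul hV

theorem contDiffAt_reduced_Hi {r : ℕ} {u : X → Param d} {w : X → ℝ}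
    {V W : X → Matrix (Fin n) (Fin r) ℂ} (hu : ContDiffAt ℝ N u x) (hw : ContDiffAt ℝ N w x)
    (hV : ContDiffAt ℝ N V x) (hW : ContDiffAt ℝ N W x) (hux : u x ∈ S.Ω)
    (hdet : ((S.reduced (V x) (W x)).Di (u x) (w x)).det ≠ 0) :
    ContDiffAt ℝ N (fun y => (S.reduced (V y) (W y)).Hi (u y) (w y)) x := by
  have hDi := S.contDiffAt_reduced_Di hu hw hV hW hux
  simp only [reduced_Di] at hDi hdet
  simp only [reduced_Hi]
  exact (((contDiffAt_sum_smul_toC S.analytic_k S.C hu hux).matrix_mul hV).matrix_mul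
    (hDi.matrix_inv hdet)).matrix_mul
      (hW.matrix_conjTranspose.matrix_mul (contDiffAt_sum_smul_toC S.analytic_h S.B hu hux))

end Smoothness

theorem continuousAt_full_Hi {x₀ : Param d × ℝ} (hx₀ : x₀.1 ∈ S.Ω)
    (hdet : (S.full.Di x₀.1 x₀.2).det ≠ 0) :
    ContinuousAt (fun x : Param d × ℝ => S.full.Hi x.1 x.2) x₀ :=
  (((contDiffAt_sum_smul_toC (N := 0) S.analytic_k S.C contDiffAt_fst hx₀).matrix_mul
    ((S.contDiffAt_full_Di contDiffAt_fst contDiffAt_snd hx₀).matrix_inv hdet)).matrix_mul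
      (contDiffAt_sum_smul_toC S.analytic_h S.B contDiffAt_fst hx₀)).continuousAt

/-- The pairs `(V, W)` of orthonormal bases for which the reduced matrix `D^{V,W}(μ, iω)` is bounded
below by `β`. -/
def boundedBelowBases (r : ℕ) (x₀ : Param d × ℝ) (β : ℝ) :
    Set (Matrix (Fin n) (Fin r) ℂ × Matrix (Fin n) (Fin r) ℂ) :=
  {q | q.1ᴴ * q.1 = 1 ∧ q.2ᴴ * q.2 = 1 ∧
    ∀ v, β * ‖v‖ ≤ ‖Matrix.toEuclideanLin ((S.reduced q.1 q.2).Di x₀.1 x₀.2) v‖}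

theorem _root_.Matrix.norm_le_one_of_conjTranspose_mul_self {a b : ℕ}
    {V : Matrix (Fin a) (Fin b) ℂ} (hV : Vᴴ * V = 1) : ‖V‖ ≤ 1 := by
  refine (Matrix.norm_le_iff zero_le_one).2 fun i j => ?_
  have h1 : ∑ k, ‖V k j‖ ^ 2 = 1 := by
    have h2 := congrFun (congrFun hV j) j
    rw [Matrix.mul_apply, Matrix.one_apply_eq] at h2
    simp only [Matrix.conjTranspose_apply, RCLike.star_def, Complex.conj_mul'] at h2
    exact_mod_cast h2
  have h3 : ‖V i j‖ ^ 2 ≤ 1 := h1 ▸ Finset.single_le_sum (f := fun k => ‖V k j‖ ^ 2)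
    (fun k _ => sq_nonneg _) (Finset.mem_univ i)
  exact (sq_le_one_iff₀ (norm_nonneg _)).1 h3

/-- Orthonormality and the lower bound for each fixed `v` are closed conditions, and orthonormal
columns have entries of modulus at most one. -/
theorem isCompact_boundedBelowBases (r : ℕ) (x₀ : Param d × ℝ) (β : ℝ) :
    IsCompact (S.boundedBelowBases r x₀ β) := by
  have : ProperSpace (Matrix (Fin n) (Fin r) ℂ) := FiniteDimensional.proper_real _
  refine Metric.isCompact_of_isClosed_isBounded ?_ ?_
  · have hset : S.boundedBelowBases r x₀ β =
        {q : Matrix (Fin n) (Fin r) ℂ × Matrix (Fin n) (Fin r) ℂ | q.1ᴴ * q.1 = 1} ∩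
        ({q | q.2ᴴ * q.2 = 1} ∩ ⋂ v, {q | β * ‖v‖ ≤
          ‖Matrix.toEuclideanLin (q.2ᴴ * S.full.Di x₀.1 x₀.2 * q.1) v‖}) := by
      ext q
      simp [boundedBelowBases, reduced_Di]
    rw [hset]
    refine IsClosed.inter (isClosed_eq (by fun_prop) continuous_const)
      (IsClosed.inter (isClosed_eq (by fun_prop) continuous_const)
        (isClosed_iInter fun v => isClosed_le continuous_const (Continuous.norm ?_)))
    simp only [Matrix.toLpLin_apply]
    fun_prop
  · refine (Metric.isBounded_closedBall (x := 0) (r := 1)).subset fun q hq => ?_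
    rw [mem_closedBall_zero_iff, Prod.norm_def]
    exact max_le (Matrix.norm_le_one_of_conjTranspose_mul_self hq.1)
      (Matrix.norm_le_one_of_conjTranspose_mul_self hq.2.1)

theorem det_ne_zero_of_mem_boundedBelowBases {r : ℕ} {x₀ : Param d × ℝ} {β : ℝ} (hβ : 0 < β)
    {q : Matrix (Fin n) (Fin r) ℂ × Matrix (Fin n) (Fin r) ℂ}
    (hq : q ∈ S.boundedBelowBases r x₀ β) : ((S.reduced q.1 q.2).Di x₀.1 x₀.2).det ≠ 0 :=
  det_ne_zero_of_mul_norm_le hβ hq.2.2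

/-- Uniform smoothness of the largest singular value of the reduced systems of a fixed order, for
bases whose transfer function is close to a matrix with a simple largest singular value. -/
theorem exists_uniform_bound_of_order (r : ℕ) {x₀ : Param d × ℝ} (hx₀ : x₀.1 ∈ S.Ω) {β : ℝ}
    (hβ : 0 < β) {H₀ : Matrix (Fin p) (Fin m) ℂ} (hH₀ : singVal H₀ 1 < singVal H₀ 0) :
    ∃ U η : ℝ, 0 < η ∧ ∀ V W, (V, W) ∈ S.boundedBelowBases r x₀ β →
      (∀ x ∈ Metric.closedBall x₀ η, ((S.reduced V W).Di x.1 x.2).det ≠ 0) ∧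
      ((∃ x ∈ Metric.closedBall x₀ η, ‖(S.reduced V W).Hi x.1 x.2 - H₀‖ ≤ η) →
        ∀ x ∈ Metric.closedBall x₀ η,
          ContDiffAt ℝ 3 (fun y : Param d × ℝ => (S.reduced V W).sigma y.1 y.2) x ∧
          ∀ χ₁ χ₂ χ₃ : Option (Fin d),
            |partialDeriv χ₁ (fun y => (S.reduced V W).sigma y.1 y.2) x| ≤ U ∧
            |partialDeriv χ₂ (partialDeriv χ₁
              (fun y => (S.reduced V W).sigma y.1 y.2)) x| ≤ U ∧
            |partialDeriv χ₃ (partialDeriv χ₂ (partialDeriv χ₁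
              (fun y => (S.reduced V W).sigma y.1 y.2))) x| ≤ U) := by
  have h𝒦 := S.isCompact_boundedBelowBases r x₀ β
  have hdet : ∀ᶠ x in 𝓝 x₀, ∀ q ∈ S.boundedBelowBases r x₀ β,
      ((S.reduced q.1 q.2).Di x.1 x.2).det ≠ 0 := by
    refine h𝒦.eventually_forall_of_forall_eventually fun q hq => ?_
    have hD : ContDiffAt ℝ 0 (fun z : (Param d × ℝ) ×
        (Matrix (Fin n) (Fin r) ℂ × Matrix (Fin n) (Fin r) ℂ) =>
        (S.reduced z.2.1 z.2.2).Di z.1.1 z.1.2) (x₀, q) :=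
      S.contDiffAt_reduced_Di contDiffAt_fst.fst contDiffAt_fst.snd contDiffAt_snd.fst
        contDiffAt_snd.snd hx₀
    exact hD.matrix_det.continuousAt.eventually_ne (S.det_ne_zero_of_mem_boundedBelowBases hβ hq)
  obtain ⟨η₂, hη₂, hball⟩ := Metric.nhds_basis_closedBall.eventually_iff.1 hdet
  obtain ⟨U, η₁, hη₁, hU⟩ := exists_uniform_bound_singVal_zero h𝒦
    (𝓗 := fun z => (S.reduced z.2.1 z.2.2).Hi z.1.1 z.1.2)
    (fun q hq => S.contDiffAt_reduced_Hi contDiffAt_fst.fst contDiffAt_fst.snd contDiffAt_snd.fst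
      contDiffAt_snd.snd hx₀ (S.det_ne_zero_of_mem_boundedBelowBases hβ hq)) hH₀
  refine ⟨U, min η₁ η₂, lt_min hη₁ hη₂, fun V W hq => ⟨fun x hx => ?_, ?_⟩⟩
  · exact hball (Metric.closedBall_subset_closedBall (min_le_right _ _) hx) (V, W) hq
  · rintro ⟨y, hy, hyH⟩ x hx
    exact hU (V, W) hq ⟨y, Metric.closedBall_subset_closedBall (min_le_left _ _) hy,
      hyH.trans (min_le_left _ _)⟩ x (Metric.closedBall_subset_closedBall (min_le_left _ _) hx)

/-- What is needed of a run of either algorithm: the outcome of the last iteration. -/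
theorem last_step_of_run {K : Set (Param d)} {k : ℕ} (hk : 1 ≤ k) {it : Iterates d n}
    (h : S.IsBasicRun K k it ∨ S.IsExtendedRun K k it) :
    (it.V k)ᴴ * it.V k = 1 ∧ (it.W k)ᴴ * it.W k = 1 ∧ it.μ k ∈ K ∧
      S.full.IsMaxFreq (it.μ k) (it.ω k) ∧
      S.full.expandV (it.μ k) (it.ω k) ≤ colSpace (it.V k) ∧
      S.full.expandW (it.μ k) (it.ω k) ≤ colSpace (it.W k) := by
  obtain ⟨j, rfl⟩ := Nat.exists_eq_add_of_le' hk
  have hgreedy : S.IsGreedy K (j + 1) it := h.elim (·.1) (·.1)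
  obtain ⟨hV, hW⟩ := hgreedy.1 (j + 1) le_rfl
  obtain ⟨⟨hμ, -⟩, hω⟩ := hgreedy.2 j j.lt_succ_self
  refine ⟨hV, hW, hμ, hω, ?_⟩
  rcases h with h | h
  · obtain ⟨hV', hW'⟩ := h.2 j j.lt_succ_self
    rw [hV', hW']
    exact ⟨le_sup_right, le_sup_right⟩
  · obtain ⟨_, -, hV', hW'⟩ := h.2 j j.lt_succ_self
    rw [hV', hW']
    exact ⟨le_sup_right.trans le_sup_left, le_sup_right.trans le_sup_left⟩

end ParamSystem

/-! ### Conclusion: finitely many orders, sign of the frequency, and assembly -/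

theorem le_of_conjTranspose_mul_self_eq_one {a b : ℕ} {V : Matrix (Fin a) (Fin b) ℂ}
    (hV : Vᴴ * V = 1) : b ≤ a := by
  calc b = (Vᴴ * V).rank := by rw [hV, Matrix.rank_one, Fintype.card_fin]
    _ ≤ V.rank := Matrix.rank_mul_le_right _ _
    _ ≤ a := V.rank_le_height

theorem ParamSystem.eventually_isMaxFreq_dist_lt {d n m p : ℕ} (S : ParamSystem d n m p)
    {K : Set (Param d)} {μ₀ : Param d} {ω₀ : ℝ} (hμ₀ : μ₀ ∈ S.Ω) (hsmooth : S.full.Smooth μ₀ ω₀)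
    (hcont : ∀ ω : OnePoint ℝ, ContinuousWithinAt
      (fun x : Param d × OnePoint ℝ => S.full.sigmaExt x.1 x.2) (K ×ˢ Set.univ) (μ₀, ω))
    (hdet₀ : (S.full.Di μ₀ ω₀).det ≠ 0) {ε : ℝ} (hε : 0 < ε) :
    ∀ᶠ μ in 𝓝 μ₀, μ ∈ K → ∀ ω, S.full.IsMaxFreq μ ω → 0 ≤ ω₀ * ω → |ω - ω₀| < ε := by
  have hdet : ∀ᶠ μ in 𝓝 μ₀, (S.full.Di μ ω₀).det ≠ 0 := by
    have h : ContDiffAt ℝ 0 (fun μ => S.full.Di μ ω₀) μ₀ :=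
      S.contDiffAt_full_Di (u := fun μ => μ) (w := fun _ => ω₀) contDiffAt_id contDiffAt_const hμ₀
    exact h.matrix_det.continuousAt.eventually_ne hdet₀
  rcases eq_or_ne ω₀ 0 with h0 | h0
  · filter_upwards [S.full.eventually_isMaxFreq_near hsmooth hcont hdet hε] with μ hμ hμK ω hω _
    simpa [h0] using hμ hμK ω hω
  · filter_upwards [S.full.eventually_isMaxFreq_near hsmooth hcont hdet
      (lt_min hε (abs_pos.2 h0))] with μ hμ hμK ω hω hsign
    refine (hμ hμK ω hω).elim (fun h => h.trans_le (min_le_left _ _)) fun h => ?_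
    have h1 := h.trans_le (min_le_right _ _)
    -- `|ω + ω₀| < |ω₀|` means `ω² + 2 ω ω₀ < 0`, against the sign condition; the radius was capped
    -- at `|ω₀|` for this purpose.
    rw [← sq_lt_sq] at h1
    nlinarith [sq_nonneg ω]

theorem lemma3p3 {d n m p : ℕ} (S : ParamSystem d n m p)
    (K : Set (Param d)) (hK : IsCompact K) (hKΩ : K ⊆ S.Ω)
    (hH : ∀ μ ∈ K, S.full.MemHinf μ)
    (μ₀ : Param d) (hμ₀ : μ₀ ∈ K) (hmin : IsLocalMinOn S.full.hinfNorm K μ₀)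
    (ω₀ : ℝ) (hsmooth : S.full.Smooth μ₀ ω₀)
    (hcont : ∀ ω : OnePoint ℝ, ContinuousWithinAt
      (fun x : Param d × OnePoint ℝ => S.full.sigmaExt x.1 x.2) (K ×ˢ Set.univ) (μ₀, ω))
    (β : ℝ) (hβ : 0 < β) (hD : β ≤ sigmaMin (S.full.Di μ₀ ω₀))
    (k : ℕ) (hk : 1 ≤ k) :
    ∃ U ημ ηω : ℝ, 0 < ημ ∧ 0 < ηω ∧ Metric.closedBall μ₀ ημ ⊆ S.Ω ∧
      ∀ R : Set (Iterates d n),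
        (∀ it ∈ R, (S.IsBasicRun K k it ∨ S.IsExtendedRun K k it) ∧ 0 ≤ ω₀ * it.ω k) →
        (∀ ε > 0, ∃ δ > 0, ∀ it ∈ R, ‖it.μ 1 - μ₀‖ < δ → ‖it.μ k - μ₀‖ < ε) →
        ∃ δ > 0, ∀ it ∈ R, ‖it.μ 1 - μ₀‖ < δ →
          β ≤ sigmaMin ((S.reducedAt it k).Di μ₀ ω₀) →
          ∀ μ ∈ Metric.closedBall μ₀ ημ, ∀ ω ∈ Metric.closedBall ω₀ ηω,
            ((S.reducedAt it k).Di μ ω).det ≠ 0 ∧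
            ContDiffAt ℝ 3
              (fun x : Param d × ℝ => (S.reducedAt it k).sigma x.1 x.2) (μ, ω) ∧
            ∀ χ₁ χ₂ χ₃ : Option (Fin d),
              |partialDeriv χ₁
                (fun x => (S.reducedAt it k).sigma x.1 x.2) (μ, ω)| ≤ U ∧
              |partialDeriv χ₂ (partialDeriv χ₁
                (fun x => (S.reducedAt it k).sigma x.1 x.2)) (μ, ω)| ≤ U ∧
              |partialDeriv χ₃ (partialDeriv χ₂ (partialDeriv χ₁
                (fun x => (S.reducedAt it k).sigma x.1 x.2))) (μ, ω)| ≤ U := by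

  have hΩ : μ₀ ∈ S.Ω := hKΩ hμ₀
  have hdet₀ : (S.full.Di μ₀ ω₀).det ≠ 0 :=
    det_ne_zero_of_mul_norm_le hβ fun x =>
      (mul_le_mul_of_nonneg_right hD (norm_nonneg x)).trans (sigmaMin_mul_norm_le _ x)
  -- Orthonormal columns force the order to be at most `n`, so a largest `U` and a smallest `η`
  -- exist. They are fixed before the family `R`; only `δ` depends on `R`.
  choose U η hη hUη using fun r : Fin (n + 1) => S.exists_uniform_bound_of_order r
    (x₀ := (μ₀, ω₀)) hΩ hβ hsmooth.2.2
  obtain ⟨rU, hrU⟩ := Finite.exists_max U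
  obtain ⟨rη, hrη⟩ := Finite.exists_min η
  obtain ⟨η', hη', hball⟩ := Metric.nhds_basis_closedBall.mem_iff.1 (S.isOpen.mem_nhds hΩ)
  have hη₀ : 0 < min (η rη) η' := lt_min (hη rη) hη'
  refine ⟨U rU, min (η rη) η', min (η rη) η', hη₀, hη₀,
    (Metric.closedBall_subset_closedBall (min_le_right _ _)).trans hball, fun R hR hRconv => ?_⟩
  have hHi : ∀ᶠ x in 𝓝 (μ₀, ω₀), ‖S.full.Hi x.1 x.2 - S.full.Hi μ₀ ω₀‖ ≤ η rη := by
    have h1 := S.continuousAt_full_Hi (x₀ := (μ₀, ω₀)) hΩ hdet₀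
    filter_upwards [h1.eventually (Metric.closedBall_mem_nhds _ (hη rη))] with x hx
    exact mem_closedBall_iff_norm.1 hx
  obtain ⟨ε, hε, hεball⟩ := Metric.nhds_basis_ball.eventually_iff.1
    (hHi.and (Metric.closedBall_mem_nhds (μ₀, ω₀) (hη rη)))
  have hnear := S.eventually_isMaxFreq_dist_lt hΩ hsmooth hcont hdet₀ hε
  obtain ⟨ε', hε', hε'ball⟩ := Metric.nhds_basis_ball.eventually_iff.1 hnear
  obtain ⟨δ, hδ, hδR⟩ := hRconv (min ε ε') (lt_min hε hε')
  refine ⟨δ, hδ, fun it hit hit1 hitβ μ hμ ω hω => ?_⟩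
  unfold ParamSystem.reducedAt at hitβ ⊢
  obtain ⟨hV, hW, hμK, hmax, hexpV, hexpW⟩ := S.last_step_of_run hk (hR it hit).1
  have hμk := hδR it hit hit1
  have hωk := hε'ball (mem_ball_iff_norm.2 (hμk.trans_le (min_le_right _ _))) hμK _ hmax
    (hR it hit).2
  have hq : (it.V k, it.W k) ∈ S.boundedBelowBases (it.dim k) (μ₀, ω₀) β :=
    ⟨hV, hW, fun v => (mul_le_mul_of_nonneg_right hitβ (norm_nonneg v)).trans
      (sigmaMin_mul_norm_le _ v)⟩
  have hr : it.dim k < n + 1 := Nat.lt_succ_of_le (le_of_conjTranspose_mul_self_eq_one hV)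
  obtain ⟨hdetr, hbound⟩ := hUη ⟨it.dim k, hr⟩ _ _ hq
  have hsub : Metric.closedBall (μ₀, ω₀) (η rη) ⊆
      Metric.closedBall (μ₀, ω₀) (η ⟨it.dim k, hr⟩) :=
    Metric.closedBall_subset_closedBall (hrη _)
  have hxk : (it.μ k, it.ω k) ∈ Metric.ball (μ₀, ω₀) ε := by
    rw [← ball_prod_same]
    exact ⟨mem_ball_iff_norm.2 (hμk.trans_le (min_le_left _ _)), mem_ball_iff_norm.2 hωk⟩
  obtain ⟨hHk, hxkη⟩ := hεball hxk
  have hx : (μ, ω) ∈ Metric.closedBall (μ₀, ω₀) (η rη) := by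
    refine Metric.closedBall_subset_closedBall (min_le_left _ η') ?_
    rw [← closedBall_prod_same]
    exact ⟨hμ, hω⟩
  -- Interpolation at the last iterate supplies the point at which the reduced transfer function is
  -- close to `H[μ₀](iω₀)`.
  have hinterp := S.reduced_Hi_eq hmax.1 (hdetr (it.μ k, it.ω k) (hsub hxkη)) hexpV hexpW
  obtain ⟨hsm, hpd⟩ := hbound ⟨(it.μ k, it.ω k), hsub hxkη, by
    rw [hinterp]
    exact hHk.trans (hrη _)⟩ (μ, ω) (hsub hx)
  refine ⟨hdetr (μ, ω) (hsub hx), hsm, fun χ₁ χ₂ χ₃ => ?_⟩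
  obtain ⟨h1, h2, h3⟩ := hpd χ₁ χ₂ χ₃
  exact ⟨h1.trans (hrU _), h2.trans (hrU _), h3.trans (hrU _)⟩
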